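/- Let $X$ be a nonempty $\sigma$-compact Hausdorff space. Let $\mathcal{O}$ be the collection of open covers of $X$. Let $\Omega$ be the collection of $\omega$-covers of $X$, that is, of open covers $\mathcal{U}$ of $X$ such that $X\notin\mathcal{U}$ and every finite subset of $X$ is contained in some $U\in\mathcal{U}$. Let $\Gamma$ be the collection of $\gamma$-covers of $X$, that is, of infinite open covers $\mathcal{U}$ of $X$ such that every $x\in X$ belongs to all but finitely many $U\in\mathcal{U}$. For families $\mathcal{A},\mathcal{B}$ of sets: - $\mathsf{S}_1(\mathcal{A},\mathcal{B})$ states that for every sequence $(O_n)_{n\in\mathbb{N}}$ of elements of $\mathcal{A}$ there are $T_n\in O_n$ $(n\in\mathbb{N})$ such that $\{T_n : n\in\mathbb{N}\}\in\mathcal{B}$. - $\mathsf{G}_1(\mathcal{A},\mathcal{B})$ is the game with one inning for each $n\in\mathbb{N}$, in which in inning $n$ player ONE chooses $O_n\in\mathcal{A}$ and then player TWO chooses $T_n\in O_n$; TWO wins the play if $\{T_n : n\in\mathbb{N}\}\in\mathcal{B}$, and otherwise ONE wins. A strategy of TWO is a function that determines $T_n$ from $(O_1,\dots,O_n)$; it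 is winning if TWO wins every play in which TWO follows it. - For positive integers $m,k$, the relation $\mathcal{A}\rightarrow(\mathcal{B})^m_k$ states that for every $A\in\mathcal{A}$ and every function $f$ from the set $[A]^m$ of $m$-element subsets of $A$ to $\{1,\dots,k\}$ there are $i\in\{1,\dots,k\}$ and $B\subseteq A$ with $B\in\mathcal{B}$ such that $f$ is constant with value $i$ on $[B]^m$. Then the following statements are equivalent: 1. $X$ satisfies $\mathsf{S}_1(\mathcal{O},\mathcal{O})$ (the Rothberger covering property). 2. TWO has a winning strategy in the game $\mathsf{G}_1(\mathcal{O},\mathcal{O})$. 3. $X$ satisfies $\mathsf{S}_1(\Omega,\Gamma)$. 4. For all positive integers $m$ and $k$, $\Omega\rightarrow(\Gamma)^m_k$ holds. -/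

import Mathlib

namespace SelectionPrinciple

/-- The selection principle `S₁(𝒜, ℬ)`: for every sequence `(O n)` of elements of `𝒜` one can
choose `T n ∈ O n` for each `n` so that the set `{T n : n ∈ ℕ}` is an element of `ℬ`. -/
def S1 {α : Type*} (𝒜 ℬ : Set (Set α)) : Prop :=
  ∀ O : ℕ → Set α, (∀ n, O n ∈ 𝒜) →
    ∃ T : ℕ → α, (∀ n, T n ∈ O n) ∧ Set.range T ∈ ℬ

/-- A strategy of player TWO assigns a move to each finite sequence of moves of player ONE. If ONE
plays `O 0, O 1, …`, then the move of TWO in inning `n` is the value at `[O 0, …, O n]`. -/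
def twoMove {α : Type*} (F : List (Set α) → α) (O : ℕ → Set α) (n : ℕ) : α :=
  F ((List.range (n + 1)).map O)

/-- `F` is a winning strategy of TWO in the game `G₁(𝒜, ℬ)`: in inning `n` ONE chooses
`O n ∈ 𝒜`, then TWO chooses `T n ∈ O n`, and TWO wins if `{T n : n ∈ ℕ} ∈ ℬ`. Against all
sequences of legal moves of ONE, the moves prescribed by `F` are legal and TWO wins the play. -/
def IsWinningForTwo {α : Type*} (𝒜 ℬ : Set (Set α)) (F : List (Set α) → α) : Prop :=
  ∀ O : ℕ → Set α, (∀ n, O n ∈ 𝒜) →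
    (∀ n, twoMove F O n ∈ O n) ∧ Set.range (twoMove F O) ∈ ℬ

/-- TWO has a winning strategy in the game `G₁(𝒜, ℬ)`. -/
def TwoWinsG1 {α : Type*} (𝒜 ℬ : Set (Set α)) : Prop :=
  ∃ F : List (Set α) → α, IsWinningForTwo 𝒜 ℬ F

/-- `[A]^m`, the set of all `m`-element subsets of `A`. -/
def subsetsOfCard {α : Type*} (A : Set α) (m : ℕ) : Set (Finset α) :=
  {s | (s : Set α) ⊆ A ∧ s.card = m}

/-- The partition relation `𝒜 → (ℬ)^m_k`: for each `A ∈ 𝒜` and each colouring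
`f : [A]^m → {1, …, k}` there are a colour `i` and a set `B ⊆ A` in `ℬ` such that `f` is constant
of value `i` on `[B]^m`. -/
def Arrow {α : Type*} (𝒜 ℬ : Set (Set α)) (m k : ℕ) : Prop :=
  ∀ A ∈ 𝒜, ∀ f : subsetsOfCard A m → Fin k,
    ∃ i : Fin k, ∃ B ⊆ A, B ∈ ℬ ∧ ∀ s : subsetsOfCard A m, (s : Finset α) ∈ subsetsOfCard B m → f s = i

/-- `𝒪`, the collection of all open covers of `X`. -/
def openCovers (X : Type*) [TopologicalSpace X] : Set (Set (Set X)) :=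
  {𝒰 | (∀ U ∈ 𝒰, IsOpen U) ∧ ⋃₀ 𝒰 = Set.univ}

/-- `Ω`, the collection of all `ω`-covers of `X`: open covers `𝒰` such that `X ∉ 𝒰` and every
finite subset of `X` is contained in an element of `𝒰`. -/
def omegaCovers (X : Type*) [TopologicalSpace X] : Set (Set (Set X)) :=
  {𝒰 | 𝒰 ∈ openCovers X ∧ Set.univ ∉ 𝒰 ∧ ∀ F : Set X, F.Finite → ∃ U ∈ 𝒰, F ⊆ U}

/-- `Γ`, the collection of all `γ`-covers of `X`: infinite open covers `𝒰` such that every point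
of `X` belongs to all but finitely many elements of `𝒰`. -/
def gammaCovers (X : Type*) [TopologicalSpace X] : Set (Set (Set X)) :=
  {𝒰 | 𝒰 ∈ openCovers X ∧ 𝒰.Infinite ∧ ∀ x : X, {U ∈ 𝒰 | x ∉ U}.Finite}

end SelectionPrinciple

/-! The pivot is the point-open game: ONE plays points, TWO answers with open neighbourhoods, and
ONE wins if these cover `X`. Under the Rothberger property ONE can force TWO to cover a compact set
in finitely many innings (`IsCompact.pointWin_of_rothberger`); by σ-compactness these plans
concatenate to a winning strategy `σ` of ONE.

This `σ` yields (2), as TWO can pick members of ONE's covers containing the points of `σ`. It yields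
(3), as each `T n` can be chosen to contain all answers of `σ` to sublists of the earlier sets; then
every infinite subsequence of `T` covers `X`. Ramsey's theorem gives (4), since infinite subsets of
γ-covers are γ-covers. Conversely, the case `m = k = 1` extracts a γ-cover from an ω-cover that
codes a sequence of open covers. -/

namespace SelectionPrinciple

open Set Filter

/-! ### Ramsey's theorem via an ultrafilter -/

section Ramsey

/-- The infinite Ramsey theorem. -/
theorem exists_infinite_homogeneous {α κ : Type*} [Finite κ] {A : Set α} (hA : A.Infinite)
    (m : ℕ) (f : Finset α → κ) :
    ∃ c : κ, ∃ H ⊆ A, H.Infinite ∧ ∀ s : Finset α, (s : Set α) ⊆ H → s.card = m → f s = c := by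
  classical
  have : (cofinite ⊓ 𝓟 A : Filter α).NeBot := cofinite_inf_principal_neBot_iff.2 hA
  let 𝒰 : Ultrafilter α := Ultrafilter.of (cofinite ⊓ 𝓟 A)
  have h𝒰 : (𝒰 : Filter α) ≤ cofinite ⊓ 𝓟 A := Ultrafilter.of_le _
  have hlim : ∀ u : α → κ, ∃ c, ∀ᶠ a in (𝒰 : Filter α), u a = c := fun u =>
    (Ultrafilter.eventually_exists_iff (f := 𝒰) (P := fun c a => u a = c)).1
      (Eventually.of_forall fun a => ⟨u a, rfl⟩)
  choose lim hlim using hlim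
  -- `g j t` is the colour of `t` enlarged by `j` generic points. A set is good if completing any of
  -- its subsets to size `m` in this way gives one fixed colour; almost every point of `A` extends a
  -- good set.
  let g : ℕ → Finset α → κ := fun j =>
    Nat.rec f (fun _ gj s => lim fun a => gj (insert a s)) j
  let good : Finset α → Prop := fun s =>
    (s : Set α) ⊆ A ∧ ∀ t ⊆ s, ∀ j, j + t.card = m → g j t = g m ∅
  have hstep : ∀ s : {s // good s}, ∃ s' : {s // good s}, s.1 ⊂ s'.1 := by
    rintro ⟨s, hsA, hs⟩
    have h1 : ∀ᶠ a in (𝒰 : Filter α), ∀ t ∈ s.powerset, ∀ j ∈ Finset.range m,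
        g j (insert a t) = g (j + 1) t := by
      refine (Finset.eventually_all _).2 fun t _ => (Finset.eventually_all _).2 fun j _ => ?_
      exact hlim fun a => g j (insert a t)
    have h2 : ∀ᶠ a in (𝒰 : Filter α), a ∉ s :=
      (h𝒰.trans inf_le_left) s.finite_toSet.compl_mem_cofinite
    have h3 : ∀ᶠ a in (𝒰 : Filter α), a ∈ A :=
      (h𝒰.trans inf_le_right) (mem_principal_self A)
    obtain ⟨a, ha1, ha2, ha3⟩ := (h1.and (h2.and h3)).exists
    refine ⟨⟨insert a s, ?_, fun t ht j hj => ?_⟩, Finset.ssubset_insert ha2⟩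
    · rw [Finset.coe_insert]
      exact insert_subset ha3 hsA
    · by_cases hat : a ∈ t
      · have hc := Finset.card_erase_add_one hat
        have hsub : t.erase a ⊆ s := Finset.subset_insert_iff.1 ht
        have := ha1 (t.erase a) (Finset.mem_powerset.2 hsub) j (Finset.mem_range.2 (by omega))
        rw [Finset.insert_erase hat] at this
        rw [this]
        exact hs _ hsub (j + 1) (by omega)
      · exact hs t ((Finset.subset_insert_iff_of_notMem hat).1 ht) j hj
  choose nxt hnxt using hstep
  have h0 : good ∅ := by
    refine ⟨by simp, fun t ht j hj => ?_⟩
    obtain rfl := Finset.subset_empty.1 ht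
    simp at hj
    rw [hj]
  let S : ℕ → {s // good s} := fun n => Nat.rec ⟨∅, h0⟩ (fun _ s => nxt s) n
  have hS : StrictMono fun n => (S n).1 := strictMono_nat_of_lt_succ fun n => hnxt (S n)
  refine ⟨g m ∅, ⋃ n, ((S n).1 : Set α), iUnion_subset fun n => (S n).2.1, fun hfin => ?_,
    fun s hs hcard => ?_⟩
  · have hinj : Function.Injective fun n => (S n).1 := hS.injective
    refine Set.infinite_range_of_injective hinj
      ((hfin.toFinset.powerset : Finset (Finset α)).finite_toSet.subset ?_)
    rintro _ ⟨n, rfl⟩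
    simp only [Finset.coe_powerset, mem_preimage, mem_powerset_iff, Finite.coe_toFinset]
    exact subset_iUnion (fun n => ((S n).1 : Set α)) n
  · have hdir : Directed (· ⊆ ·) fun n => ((S n).1 : Set α) :=
      Monotone.directed_le fun i j hij => Finset.coe_subset.2 (hS.monotone hij)
    obtain ⟨n, hn⟩ := hdir.exists_mem_subset_of_finset_subset_biUnion hs
    exact (S n).2.2 s (Finset.coe_subset.1 hn) 0 (by omega)

end Ramsey

/-! ### The point-open game -/

section PointOpen

variable {X : Type*} [TopologicalSpace X]

variable (X) in
/-- A plan of ONE for finitely many innings of the point-open game, in which ONE chooses points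
and TWO chooses open neighbourhoods of them: either end, or play `x` and follow the plan
`next V` if TWO answers with `V`. -/
inductive PointPlan : Type _
  | nil : PointPlan
  | play (x : X) (next : Set X → PointPlan) : PointPlan

/-- Following the plan, ONE forces TWO to cover `C`. -/
def PointPlan.Covers : PointPlan X → Set X → Prop
  | .nil, C => C = ∅
  | .play x next, C => ∀ V, IsOpen V → x ∈ V → (next V).Covers (C \ V)

/-- In the point-open game ONE can force TWO to cover `C` after finitely many innings. -/
def PointWin (C : Set X) : Prop := ∃ p : PointPlan X, p.Covers C

theorem PointWin.empty : PointWin (∅ : Set X) := ⟨.nil, rfl⟩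

theorem PointWin.step {C : Set X} (x : X)
    (h : ∀ V, IsOpen V → x ∈ V → PointWin (C \ V)) : PointWin C := by
  have h' : ∀ V, ∃ p : PointPlan X, IsOpen V → x ∈ V → p.Covers (C \ V) := by
    intro V
    by_cases hV : IsOpen V ∧ x ∈ V
    · exact (h V hV.1 hV.2).imp fun p hp _ _ => hp
    · exact ⟨.nil, fun h1 h2 => absurd ⟨h1, h2⟩ hV⟩
  choose next hnext using h'
  exact ⟨.play x next, hnext⟩

theorem exists_openCover_of_not_pointWin {C : Set X} (hC : ¬ PointWin C) :
    ∃ 𝒰 ∈ openCovers X, ∀ U ∈ 𝒰, ¬ PointWin (C \ U) := by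
  have h : ∀ x : X, ∃ V, IsOpen V ∧ x ∈ V ∧ ¬ PointWin (C \ V) := by
    intro x
    by_contra! h
    exact hC (.step x h)
  choose V hVo hxV hV using h
  refine ⟨range V, ⟨?_, ?_⟩, ?_⟩
  · rintro _ ⟨x, rfl⟩
    exact hVo x
  · exact eq_univ_of_forall fun x => ⟨V x, mem_range_self x, hxV x⟩
  · rintro _ ⟨x, rfl⟩
    exact hV x

/-- Otherwise finite subcovers of K by bad answers of TWO span a finitely branching tree of
remainders that ONE cannot win. A Rothberger selection determines a branch avoiding the selected
sets, but finitely many of these cover `K`. -/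
theorem _root_.IsCompact.pointWin_of_rothberger {K : Set X} (hK : IsCompact K)
    (hKc : IsClosed K) (h : S1 (openCovers X) (openCovers X)) : PointWin K := by
  classical
  by_contra hKw
  obtain ⟨k, hk⟩ : K.Nonempty := by
    rw [nonempty_iff_ne_empty]
    rintro rfl
    exact hKw .empty
  have ht : ∀ C : Set X, ∃ t : Finset (Set X), (∀ U ∈ t, IsOpen U) ∧ K ⊆ ⋃₀ (t : Set (Set X)) ∧
      (¬ PointWin C → ∀ U ∈ t, ¬ PointWin (C \ U)) := by
    intro C
    by_cases hC : PointWin C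
    · exact ⟨{univ}, by simp, by simp, fun h => absurd hC h⟩
    · obtain ⟨𝒰, ⟨ho, hcov⟩, hn⟩ := exists_openCover_of_not_pointWin hC
      obtain ⟨t, ht, htf, htK⟩ := hK.elim_finite_subcover_image (b := 𝒰) (c := id) ho
        (by simp only [id, ← sUnion_eq_biUnion, hcov, subset_univ])
      refine ⟨htf.toFinset, fun U hU => ho U (ht (htf.mem_toFinset.1 hU)), ?_,
        fun _ U hU => hn U (ht (htf.mem_toFinset.1 hU))⟩
      rwa [htf.coe_toFinset, sUnion_eq_biUnion]
  choose t hto htK htw using ht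
  let F : ℕ → Finset (Set X) := fun n =>
    Nat.rec {K} (fun _ Fn => Fn.biUnion fun C => (t C).image (C \ ·)) n
  -- A common refinement over all nodes of level `n`, so that one selected set decides the next step
  -- at whichever node the branch has reached.
  let W : ℕ → Set (Set X) := fun n =>
    {V | ∃ g : Set X → Set X, (∀ C ∈ F n, g C ∈ t C) ∧ V = (⋂ C ∈ F n, g C) ∪ Kᶜ}
  have hW : ∀ n, W n ∈ openCovers X := by
    refine fun n => ⟨?_, eq_univ_of_forall fun x => ?_⟩
    · rintro _ ⟨g, hg, rfl⟩
      exact (isOpen_biInter_finset fun C hC => hto C _ (hg C hC)).union hKc.isOpen_compl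
    · have key : ∀ y ∈ K, ∃ V ∈ W n, y ∈ V ∧ Kᶜ ⊆ V := by
        intro y hy
        choose g hg hyg using fun C => htK C hy
        exact ⟨_, ⟨g, fun C _ => hg C, rfl⟩, .inl (mem_iInter₂.2 fun C _ => hyg C),
          subset_union_right⟩
      by_cases hx : x ∈ K
      · obtain ⟨V, hV, hxV, -⟩ := key x hx
        exact ⟨V, hV, hxV⟩
      · obtain ⟨V, hV, -, hKV⟩ := key k hk
        exact ⟨V, hV, hKV hx⟩
  obtain ⟨T, hT, hTo, hTcov⟩ := h W hW
  choose g hg hTg using hT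
  let C : ℕ → Set X := fun n => Nat.rec K (fun n Cn => Cn \ g n Cn) n
  have hCF : ∀ n, C n ∈ F n := by
    intro n
    induction n with
    | zero => exact Finset.mem_singleton_self K
    | succ n ih =>
      exact Finset.mem_biUnion.2 ⟨C n, ih, Finset.mem_image.2 ⟨g n (C n), hg n _ ih, rfl⟩⟩
  have hCw : ∀ n, ¬ PointWin (C n) := by
    intro n
    induction n with
    | zero => exact hKw
    | succ n ih => exact htw _ ih _ (hg n _ (hCF n))
  have hCK : ∀ n, C n ⊆ K := by
    intro n
    induction n with
    | zero => exact subset_rfl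
    | succ n ih => exact sdiff_subset.trans ih
  have hCanti : Antitone C := antitone_nat_of_succ_le fun n => sdiff_subset
  have hCT : ∀ n, Disjoint (C (n + 1)) (T n) := by
    refine fun n => disjoint_left.2 fun x hx hxT => ?_
    rw [hTg n] at hxT
    rcases hxT with hxT | hxT
    · exact hx.2 (mem_iInter₂.1 hxT _ (hCF n))
    · exact hxT (hCK (n + 1) hx)
  obtain ⟨s, hs⟩ := hK.elim_finite_subcover T (fun n => hTo _ (mem_range_self n))
    (by rw [← sUnion_range, hTcov]; exact subset_univ K)
  obtain ⟨N, hN⟩ := s.exists_nat_subset_range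
  refine hCw N ?_
  suffices C N = ∅ by rw [this]; exact .empty
  refine eq_empty_of_forall_notMem fun x hx => ?_
  obtain ⟨i, hi, hxi⟩ := mem_iUnion₂.1 (hs (hCK N hx))
  exact disjoint_left.1 (hCT i) (hCanti (Finset.mem_range.1 (hN hi)) hx) hxi

/-- `σ` is a winning strategy of ONE in the point-open game on `X`. -/
def IsPointOpenWinning (σ : List (Set X) → X) : Prop :=
  ∀ V : ℕ → Set X, (∀ n, IsOpen (V n)) → (∀ n, σ ((List.range n).map V) ∈ V n) →
    ⋃ n, V n = univ

theorem exists_isPointOpenWinning [Nonempty X] {K : ℕ → Set X} (hK : ∀ n, PointWin (K n))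
    (hcov : ⋃ n, K n = univ) : ∃ σ : List (Set X) → X, IsPointOpenWinning σ := by
  classical
  choose plan hplan using hK
  let pt : PointPlan X → X
    | .nil => Classical.arbitrary X
    | .play x _ => x
  -- The state is the index of the current piece and the rest of its plan; at the end of a plan, one
  -- inning is spent on a dummy point to pass to the next piece.
  let next : ℕ × PointPlan X → Set X → ℕ × PointPlan X
    | (n, .nil), _ => (n + 1, plan (n + 1))
    | (n, .play _ c), V => (n, c V)
  refine ⟨fun l => pt (l.foldl next (0, plan 0)).2, fun V hVo hV => ?_⟩
  let st : ℕ → ℕ × PointPlan X := fun i => ((List.range i).map V).foldl next (0, plan 0)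
  have hst : ∀ i, st (i + 1) = next (st i) (V i) := fun i => by simp [st, List.range_succ]
  have hrun : ∀ (p : PointPlan X) (C : Set X), p.Covers C → ∀ n i, st i = (n, p) →
      C ⊆ ⋃ j, V j ∧ ∃ j, st j = (n + 1, plan (n + 1)) := by
    intro p
    induction p with
    | nil =>
      rintro C rfl n i hi
      exact ⟨empty_subset _, i + 1, by rw [hst, hi]⟩
    | play x c ih =>
      intro C hC n i hi
      have hx : x ∈ V i := by
        have := hV i
        change pt (st i).2 ∈ V i at this
        rwa [hi] at this
      obtain ⟨h1, h2⟩ := ih (V i) _ (hC (V i) (hVo i) hx) n (i + 1) (by rw [hst, hi])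
      refine ⟨fun y hy => ?_, h2⟩
      by_cases hyV : y ∈ V i
      · exact mem_iUnion_of_mem i hyV
      · exact h1 ⟨hy, hyV⟩
  have hreach : ∀ n, ∃ i, st i = (n, plan n) := by
    intro n
    induction n with
    | zero => exact ⟨0, rfl⟩
    | succ n ih =>
      obtain ⟨i, hi⟩ := ih
      exact (hrun _ _ (hplan n) n i hi).2
  refine eq_univ_of_forall fun x => ?_
  obtain ⟨n, hn⟩ := mem_iUnion.1 (hcov.symm ▸ mem_univ x : x ∈ ⋃ n, K n)
  obtain ⟨i, hi⟩ := hreach n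
  exact (hrun _ _ (hplan n) n i hi).1 hn

theorem IsPointOpenWinning.twoWinsG1 {σ : List (Set X) → X} (hσ : IsPointOpenWinning σ) :
    TwoWinsG1 (openCovers X) (openCovers X) := by
  have hpick : ∀ (x : X) (O : Set (Set X)), ∃ U, O ∈ openCovers X → U ∈ O ∧ x ∈ U := by
    intro x O
    by_cases hO : O ∈ openCovers X
    · obtain ⟨U, hU⟩ := mem_sUnion.1 (hO.2.symm ▸ mem_univ x : x ∈ ⋃₀ O)
      exact ⟨U, fun _ => hU⟩
    · exact ⟨∅, fun h => absurd h hO⟩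
  choose pick hpick using hpick
  -- TWO's strategy sees only ONE's covers, so it must recompute its own earlier moves to feed them
  -- to `σ`.
  let hist : List (Set (Set X)) → List (Set X) :=
    List.foldl (fun l O => l ++ [pick (σ l) O]) []
  let F : List (Set (Set X)) → Set X := fun l => (hist l).getLastD ∅
  have hF : ∀ O n, twoMove F O n = pick (σ (hist ((List.range n).map O))) (O n) := by
    intro O n
    simp [twoMove, F, hist, List.range_succ]
  have hhist : ∀ O n, hist ((List.range n).map O) = (List.range n).map (twoMove F O) := by
    intro O n
    induction n with
    | zero => rfl
    | succ n ih =>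
      rw [List.range_succ, List.map_append, List.map_append, ← ih, List.map_singleton,
        List.map_singleton, hF]
      simp [hist]
  refine ⟨F, fun O hO => ?_⟩
  have hmem : ∀ n, twoMove F O n ∈ O n ∧
      σ ((List.range n).map (twoMove F O)) ∈ twoMove F O n := by
    intro n
    rw [← hhist, hF]
    exact hpick _ _ (hO n)
  have hopen : ∀ n, IsOpen (twoMove F O n) := fun n => (hO n).1 _ (hmem n).1
  refine ⟨fun n => (hmem n).1, ?_, ?_⟩
  · rintro _ ⟨n, rfl⟩
    exact hopen n
  · rw [sUnion_range]
    exact hσ _ hopen fun n => (hmem n).2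

/-- Values of `T` may repeat, but none infinitely often: it would omit some point, which would then
be missed infinitely often. Hence the range is infinite. -/
theorem range_mem_gammaCovers [Nonempty X] {T : ℕ → Set X} (ho : ∀ n, IsOpen (T n))
    (hne : ∀ n, T n ≠ univ) (hT : ∀ x, {n | x ∉ T n}.Finite) : range T ∈ gammaCovers X := by
  refine ⟨⟨?_, eq_univ_of_forall fun x => ?_⟩, fun hfin => ?_, fun x => ?_⟩
  · rintro _ ⟨n, rfl⟩
    exact ho n
  · obtain ⟨n, hn⟩ := (hT x).infinite_compl.nonempty
    exact ⟨T n, mem_range_self n, not_not.1 hn⟩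
  · have : Finite (range T) := hfin
    obtain ⟨⟨_, n, rfl⟩, hU⟩ := Finite.exists_infinite_fiber (rangeFactorization T)
    obtain ⟨x, hx⟩ := (ne_univ_iff_exists_notMem _).1 (hne n)
    refine (infinite_coe_iff.1 hU) ((hT x).subset fun i hi => ?_)
    have : T i = T n := congrArg Subtype.val hi
    rwa [mem_ofPred_eq, this]
  · refine ((hT x).image T).subset ?_
    rintro _ ⟨⟨n, rfl⟩, hn⟩
    exact ⟨n, hn, rfl⟩

theorem map_range_sublist_range {e : ℕ → ℕ} (he : StrictMono e) (k : ℕ) :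
    ((List.range k).map e).Sublist (List.range (e k)) := by
  induction k with
  | zero => simp
  | succ k ih =>
    have h : (List.range (e k + 1)).Sublist (List.range (e (k + 1))) :=
      List.range_sublist.2 (he k.lt_succ_self)
    rw [List.range_succ] at h ⊢
    rw [List.map_append]
    exact (ih.append_right _).trans h

theorem IsPointOpenWinning.S1_omegaCovers_gammaCovers [Nonempty X] {σ : List (Set X) → X}
    (hσ : IsPointOpenWinning σ) : S1 (omegaCovers X) (gammaCovers X) := by
  intro O hO
  have hτ : ∀ l : List (Set X), ∃ U ∈ O l.length, {x | ∃ l', l'.Sublist l ∧ σ l' = x} ⊆ U := by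
    intro l
    refine (hO l.length).2.2 _ ((l.sublists.finite_toSet.image σ).subset ?_)
    rintro _ ⟨l', hl', rfl⟩
    exact ⟨l', List.mem_sublists.2 hl', rfl⟩
  choose τ hτO hτ using hτ
  let L : ℕ → List (Set X) := fun n => Nat.rec [] (fun _ l => l ++ [τ l]) n
  let T : ℕ → Set X := fun n => τ (L n)
  have hL : ∀ n, L n = (List.range n).map T := by
    intro n
    induction n with
    | zero => rfl
    | succ n ih =>
      rw [List.range_succ, List.map_append, ← ih]
      rfl
  have hTO : ∀ n, T n ∈ O n := by
    intro n
    have := hτO (L n)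
    rwa [hL n, List.length_map, List.length_range, ← hL n] at this
  have ho : ∀ n, IsOpen (T n) := fun n => (hO n).1.1 _ (hTO n)
  refine ⟨T, hTO, range_mem_gammaCovers ho (fun n h => (hO n).2.1 (h ▸ hTO n)) fun x => ?_⟩
  by_contra hinf
  have hinf : {n | x ∉ T n}.Infinite := hinf
  -- The sets missing `x` form a legal play of TWO against `σ`, hence cover `x`.
  let e : ℕ → ℕ := Nat.nth fun n => x ∉ T n
  have he : StrictMono e := Nat.nth_strictMono hinf
  have hcov := hσ (fun k => T (e k)) (fun k => ho _) fun k => by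
    refine hτ (L (e k)) ⟨_, ?_, rfl⟩
    rw [hL]
    have := (map_range_sublist_range he k).map T
    rwa [List.map_map] at this
  obtain ⟨k, hk⟩ := mem_iUnion.1 (hcov.symm ▸ mem_univ x)
  exact Nat.nth_mem_of_infinite hinf k hk

end PointOpen

/-! ### Partition relations and the return to the Rothberger property -/

section Covers

variable {X : Type*} [TopologicalSpace X]

theorem TwoWinsG1.S1 {α : Type*} {𝒜 ℬ : Set (Set α)} (h : TwoWinsG1 𝒜 ℬ) : S1 𝒜 ℬ := by
  obtain ⟨F, hF⟩ := h
  exact fun O hO => ⟨twoMove F O, hF O hO⟩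

theorem gammaCovers_of_subset {𝒰 𝒱 : Set (Set X)} (h𝒰 : 𝒰 ∈ gammaCovers X) (h : 𝒱 ⊆ 𝒰)
    (hinf : 𝒱.Infinite) : 𝒱 ∈ gammaCovers X := by
  have hfin : ∀ x, {U ∈ 𝒱 | x ∉ U}.Finite := fun x =>
    (h𝒰.2.2 x).subset fun U hU => ⟨h hU.1, hU.2⟩
  refine ⟨⟨fun U hU => h𝒰.1.1 U (h hU), eq_univ_of_forall fun x => ?_⟩, hinf, hfin⟩
  obtain ⟨U, hU, hx⟩ := (hinf.sdiff (hfin x)).nonempty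
  exact ⟨U, hU, by_contra fun hxU => hx ⟨hU, hxU⟩⟩

theorem arrow_of_S1 (h : S1 (omegaCovers X) (gammaCovers X)) {m k : ℕ} (hk : 1 ≤ k) :
    Arrow (omegaCovers X) (gammaCovers X) m k := by
  classical
  intro A hA f
  obtain ⟨T, hT, hTγ⟩ := h (fun _ => A) fun _ => hA
  obtain ⟨c, H, hH, hinf, hc⟩ := exists_infinite_homogeneous hTγ.2.1 m
    fun s => if hs : s ∈ subsetsOfCard A m then f ⟨s, hs⟩ else ⟨0, hk⟩
  refine ⟨c, H, hH.trans (range_subset_iff.2 hT), gammaCovers_of_subset hTγ hH hinf, ?_⟩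
  rintro ⟨s, hs⟩ hsH
  simpa [hs] using hc s hsH.1 hsH.2

/-- A finite `X` has no ω-covers, so (4) is vacuous there and the Rothberger property needs its own
argument. -/
theorem rothberger_of_finite [Finite X] [Nonempty X] : S1 (openCovers X) (openCovers X) := by
  intro O hO
  obtain ⟨e, he⟩ := exists_surjective_nat X
  have h : ∀ n, ∃ U ∈ O n, e n ∈ U := fun n =>
    mem_sUnion.1 ((hO n).2.symm ▸ mem_univ (e n) : e n ∈ ⋃₀ O n)
  choose T hT heT using h
  refine ⟨T, hT, ?_, eq_univ_of_forall fun x => ?_⟩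
  · rintro _ ⟨n, rfl⟩
    exact (hO n).1 _ (hT n)
  · obtain ⟨n, rfl⟩ := he x
    exact ⟨T n, mem_range_self n, heT n⟩

theorem rothberger_of_arrow [T1Space X] [Infinite X]
    (h : Arrow (omegaCovers X) (gammaCovers X) 1 1) : S1 (openCovers X) (openCovers X) := by
  intro O hO
  have hpick : ∀ (x : X) (n : ℕ), ∃ U ∈ O n, x ∈ U := fun x n =>
    mem_sUnion.1 ((hO n).2.symm ▸ mem_univ x : x ∈ ⋃₀ O n)
  let y : ℕ → X := Infinite.natEmbedding X
  have hy : Function.Injective y := (Infinite.natEmbedding X).injective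
  -- Pairing reserves an infinite block of covers for each `n`. Deleting `y n` keeps `X` out and
  -- lets a γ-cover contain only finitely many members of `W n`.
  let W : ℕ → Set (Set X) := fun n =>
    {V | ∃ U : ℕ → Set X, (∀ i, U i ∈ O (Nat.pair n i)) ∧ ∃ N, V = (⋃ i < N, U i) \ {y n}}
  have hopen : ∀ V ∈ ⋃ n, W n, IsOpen V := by
    intro V hV
    obtain ⟨n, U, hU, N, rfl⟩ := mem_iUnion.1 hV
    exact (isOpen_biUnion fun i _ => (hO _).1 _ (hU i)).sdiff isClosed_singleton
  have homega : ∀ F : Set X, F.Finite → ∃ V ∈ ⋃ n, W n, F ⊆ V := by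
    intro F hF
    obtain ⟨n, hn⟩ : ∃ n, y n ∉ F := by
      by_contra! hall
      exact infinite_range_of_injective hy (hF.subset (range_subset_iff.2 hall))
    obtain ⟨e, he⟩ : ∃ e : ℕ → X, F ⊆ range e := by
      obtain ⟨e, he⟩ := (hF.insert (y 0)).countable.exists_eq_range (insert_nonempty _ _)
      exact ⟨e, he ▸ subset_insert _ _⟩
    choose U hU heU using fun i => hpick (e i) (Nat.pair n i)
    have hmono : Directed (· ⊆ ·) fun N => ⋃ i < N, U i :=
      Monotone.directed_le fun M N hMN => biUnion_subset_biUnion_left fun i hi =>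
        lt_of_lt_of_le hi hMN
    obtain ⟨N, hN⟩ := hmono.exists_mem_subset_of_finset_subset_biUnion (s := hF.toFinset) (by
      intro x hx
      obtain ⟨i, rfl⟩ := he (hF.mem_toFinset.1 hx)
      exact mem_iUnion_of_mem (i + 1) (mem_biUnion i.lt_succ_self (heU i)))
    refine ⟨_, mem_iUnion_of_mem n ⟨U, hU, N, rfl⟩, fun x hx => ⟨hN ?_, ?_⟩⟩
    · exact hF.mem_toFinset.2 hx
    · rintro rfl
      exact hn hx
  have hWΩ : (⋃ n, W n) ∈ omegaCovers X := by
    refine ⟨⟨hopen, eq_univ_of_forall fun x => ?_⟩, fun hu => ?_, homega⟩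
    · obtain ⟨V, hV, hx⟩ := homega {x} (finite_singleton x)
      exact ⟨V, hV, hx rfl⟩
    · obtain ⟨n, U, -, N, hV⟩ := mem_iUnion.1 hu
      exact (hV ▸ mem_univ (y n) : y n ∈ (⋃ i < N, U i) \ {y n}).2 rfl
  obtain ⟨-, B, hBW, hB, -⟩ := h _ hWΩ fun _ => 0
  choose! ν hν using fun V (hV : V ∈ B) => mem_iUnion.1 (hBW hV)
  have hνinf : (ν '' B).Infinite := by
    intro hfin
    refine hB.2.1 (Finite.of_finite_fibers ν hfin fun n _ => (hB.2.2 (y n)).subset ?_)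
    rintro V ⟨hV, rfl⟩
    obtain ⟨U, -, N, hVN⟩ := hν V hV
    refine ⟨hV, fun hy => ?_⟩
    exact (hVN.subset hy).2 rfl
  -- Keep one member per index, so that no two members compete for the same block of covers.
  obtain ⟨B', hB', hbij⟩ := (surjOn_image ν B).exists_bijOn_subset
  have hB'inf : B'.Infinite := fun hfin => hνinf (hbij.image_eq ▸ hfin.image ν)
  have hB'cov := (gammaCovers_of_subset hB hB' hB'inf).1.2
  have hsel : ∀ n, ∃ U : ℕ → Set X, (∀ i, U i ∈ O (Nat.pair n i)) ∧
      ∀ V ∈ B', ν V = n → V ⊆ ⋃ i, U i := by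
    intro n
    by_cases hn : ∃ V ∈ B', ν V = n
    · obtain ⟨V, hV, rfl⟩ := hn
      obtain ⟨U, hU, N, hVN⟩ := hν V (hB' hV)
      refine ⟨U, hU, fun V' hV' hVV' => ?_⟩
      rw [hbij.injOn hV' hV hVV', hVN]
      exact sdiff_subset.trans (iUnion₂_subset fun i _ => subset_iUnion U i)
    · choose U hU _ using fun i => hpick (y 0) (Nat.pair n i)
      exact ⟨U, hU, fun V hV hVn => absurd ⟨V, hV, hVn⟩ hn⟩
  choose U hU hUV using hsel
  have hTO : ∀ m, U m.unpair.1 m.unpair.2 ∈ O m := fun m => by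
    simpa using hU m.unpair.1 m.unpair.2
  refine ⟨fun m => U m.unpair.1 m.unpair.2, hTO, ?_, eq_univ_of_forall fun x => ?_⟩
  · rintro _ ⟨m, rfl⟩
    exact (hO m).1 _ (hTO m)
  · obtain ⟨V, hV, hxV⟩ := mem_sUnion.1 (hB'cov.symm ▸ mem_univ x : x ∈ ⋃₀ B')
    obtain ⟨i, hi⟩ := mem_iUnion.1 (hUV _ V hV rfl hxV)
    exact ⟨_, ⟨Nat.pair (ν V) i, rfl⟩, by simpa using hi⟩

end Covers

end SelectionPrinciple

theorem mainTheorem4 (X : Type*) [TopologicalSpace X] [T2Space X] [SigmaCompactSpace X]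
    [Nonempty X] :
    List.TFAE [
      SelectionPrinciple.S1 (SelectionPrinciple.openCovers X) (SelectionPrinciple.openCovers X),
      SelectionPrinciple.TwoWinsG1
        (SelectionPrinciple.openCovers X) (SelectionPrinciple.openCovers X),
      SelectionPrinciple.S1 (SelectionPrinciple.omegaCovers X) (SelectionPrinciple.gammaCovers X),
      ∀ m k : ℕ, 1 ≤ m → 1 ≤ k →
        SelectionPrinciple.Arrow
          (SelectionPrinciple.omegaCovers X) (SelectionPrinciple.gammaCovers X) m k] := by
  open SelectionPrinciple in
  have hwin : S1 (openCovers X) (openCovers X) →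
      ∃ σ : List (Set X) → X, IsPointOpenWinning σ := fun h =>
    exists_isPointOpenWinning
      (fun n => (isCompact_compactCovering X n).pointWin_of_rothberger
        (isCompact_compactCovering X n).isClosed h)
      (iUnion_compactCovering X)
  tfae_have 1 → 2 := fun h => (hwin h).elim fun _ hσ => hσ.twoWinsG1
  tfae_have 2 → 1 := SelectionPrinciple.TwoWinsG1.S1
  tfae_have 1 → 3 := fun h => (hwin h).elim fun _ hσ => hσ.S1_omegaCovers_gammaCovers
  tfae_have 3 → 4 := fun h m k _ hk => SelectionPrinciple.arrow_of_S1 h hk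
  tfae_have 4 → 1 := fun h => by
    cases finite_or_infinite X
    · exact SelectionPrinciple.rothberger_of_finite
    · exact SelectionPrinciple.rothberger_of_arrow (h 1 1 le_rfl le_rfl)
  tfae_finish
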